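/- Let $P_1,\dots,P_m$ be smooth compact manifolds (possibly with boundary), and let $\mathcal O(\vec P)=\prod_i\mathcal O(P_i)$ be the poset of $m$-tuples $\vec U=(U_1,\dots,U_m)$ of open sets $U_i\subseteq P_i$. Let $F$ be a contravariant functor from $\mathcal O(\vec P)$ to fibrant simplicial sets (Kan complexes). For a tuple of integers $\vec k=(k_1,\dots,k_m)$ let $\mathcal O_{\vec k}(\vec U)$ be the poset of all $\vec V\le\vec U$ such that each $V_i$ is diffeomorphic to a disjoint union of at most $k_i$ open balls (this poset is empty if some $k_i<0$), and let $$T_{\vec k}F(\vec U)=\operatorname*{holim}_{\vec V\in\mathcal O_{\vec k}(\vec U)}F(\vec V),$$ where $\operatorname{holim}$ is the Bousfield--Kan homotopy limit (over the empty poset it is a point). For $\vec k\le\vec k'$ restriction gives a natural map $T_{\vec k'}F\to T_{\vec k}F$. Let $\vec\jmath=(j_1,\dots,j_m)$ be a tuple of non-negative integers. Write $\vec k<\vec\jmath$ for tuples $\vec k$ of non-negative integers with $k_i\le j_i$ for all $i$ and $k_i<j_i$ for some $i$. For $R\subseteq\{1,\dots,m\}$ let $\vec\jmath_R$ be obtained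 from $\vec\jmath$ by replacing $j_i$ by $j_i-1$ for all $i\in R$, so that $R\mapsto T_{\vec\jmath_R}F$ is an $m$-cube of functors with initial vertex $T_{\vec\jmath_\emptyset}F=T_{\vec\jmath}F$. Then there is an equivalence of functors on $\mathcal O(\vec P)$ (a natural transformation which is a homotopy equivalence for every $\vec U$) $$\operatorname*{holim}_{\vec k<\vec\jmath}T_{\vec k}F\;\xrightarrow{\ \simeq\ }\;\operatorname*{holim}_{\emptyset\ne R\subseteq\{1,\dots,m\}}T_{\vec\jmath_R}F ,$$ compatible with the canonical maps from $T_{\vec\jmath}F$ to both sides. Consequently, for every choice of a basepoint in $F(\vec P)$, the layer $$L_{\vec\jmath}F=\operatorname{hofiber}\Big(T_{\vec\jmath}F\to\operatorname*{holim}_{\vec k<\vec\jmath}T_{\vec k}F\Big)$$ is equivalent, as a functor on $\mathcal O(\vec P)$ and compatibly with the projections to $T_{\vec\jmath}F$, to the total homotopy fiber $$\operatorname{hofiber}\Big(T_{\vec\jmath_\emptyset}F\to\operatorname*{holim}_{R\ne\emptyset}T_{\vec\jmath_R}F\Big)$$ of the $m$-cube $R\mapsto T_{\vec\jmath_R}F$.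 -/

import Mathlib

open CategoryTheory Opposite MonoidalCategory Simplicial TopologicalSpace
open scoped ContDiff

universe w v u w' v'

namespace ManifoldCalculus

/-! ### Homotopy equivalences of simplicial sets -/

/-- Two maps of simplicial sets are homotopic if they are related by the equivalence relation
generated by homotopies `X ⊗ Δ[1] ⟶ Y`. (If `Y` is a Kan complex, one such homotopy suffices.) -/
def Homotopic {X Y : SSet.{u}} : (X ⟶ Y) → (X ⟶ Y) → Prop :=
  Relation.EqvGen fun f g => Nonempty (SSet.Homotopy f g)

/-- Equivalences of spaces: the maps which have a homotopy inverse. Between Kan complexes these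
are exactly the weak equivalences. -/
def IsEquivalence {X Y : SSet.{u}} (f : X ⟶ Y) : Prop :=
  ∃ g : Y ⟶ X, Homotopic (f ≫ g) (𝟙 X) ∧ Homotopic (g ≫ f) (𝟙 Y)

/-- Equivalences of space-valued functors: natural transformations which are equivalences
objectwise. -/
def IsFunctorEquivalence {C : Type w} [Category.{v} C] {F G : C ⥤ SSet.{u}} (φ : F ⟶ G) : Prop :=
  ∀ c, IsEquivalence (φ.app c)

/-! ### Homotopy limits

The homotopy limit of `X : C ⥤ SSet` is the Bousfield--Kan one: the simplicial set of natural
transformations from `c ↦ N(C / c)` to `X`. An `n`-simplex is a family of maps of simplicial sets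
`N(C / c) × Δ[n] ⟶ X c` which is natural in `c`. -/

/-- An `n`-simplex of the homotopy limit of `X`. -/
@[ext]
structure HolimSimplex {C : Type w} [Category.{v} C] (X : C ⥤ SSet.{u})
    (n : SimplexCategoryᵒᵖ) where
  /-- The map `N(C / c) × Δ[n] ⟶ X c` on `k`-simplices; a `k`-simplex of `Δ[n]` is a map
  `k ⟶ n` in the simplex category. -/
  app (c : C) (k : SimplexCategoryᵒᵖ) :
    (nerve (Over c)).obj k → (k.unop ⟶ n.unop) → (X.obj c).obj k
  map_simplex (c : C) {k k' : SimplexCategoryᵒᵖ} (g : k ⟶ k') (s : (nerve (Over c)).obj k)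
    (t : k.unop ⟶ n.unop) :
    app c k' ((nerve (Over c)).map g s) (g.unop ≫ t) = (X.obj c).map g (app c k s t)
  map_object {c c' : C} (g : c ⟶ c') (k : SimplexCategoryᵒᵖ) (s : (nerve (Over c)).obj k)
    (t : k.unop ⟶ n.unop) :
    app c' k ((nerveMap (Over.map g)).app k s) t = (X.map g).app k (app c k s t)

/-- The homotopy limit of a diagram of simplicial sets. -/
def holim {C : Type w} [Category.{v} C] (X : C ⥤ SSet.{u}) : SSet.{max w v u} where
  obj n := HolimSimplex X n
  map {n n'} h := TypeCat.ofHom fun x =>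
    { app := fun c k s t => x.app c k s (t ≫ h.unop)
      map_simplex := fun c k k' g s t => by
        rw [Category.assoc, x.map_simplex]
      map_object := fun g k s t => x.map_object g k s _ }
  map_id n := by
    ext x c k s t
    simp
  map_comp g h := by
    ext x c k s t
    simp

theorem map_comp_post {C : Type w} [Category.{v} C] {D : Type w'} [Category.{v'} D] (p : D ⥤ C)
    {d d' : D} (g : d ⟶ d') :
    Over.map g ⋙ Over.post p = Over.post p ⋙ Over.map (p.map g) := by
  have hobj : ∀ X : Over d, (Over.map g ⋙ Over.post p).obj X =
      (Over.post p ⋙ Over.map (p.map g)).obj X := fun X =>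
    congrArg (fun h : p.obj X.left ⟶ p.obj d' => Over.mk h) (p.map_comp X.hom g)
  have hleft : ∀ {A B : Over (p.obj d')} (h : A = B),
      (eqToHom h).left = eqToHom (congrArg (fun Z : Over (p.obj d') => Z.left) h) := by
    rintro A _ rfl
    rfl
  refine CategoryTheory.Functor.ext hobj (fun X Y f => ?_)
  apply Over.OverMorphism.ext
  rw [Over.comp_left, Over.comp_left, hleft, hleft]
  exact ((Category.id_comp _).trans (Category.comp_id _)).symm

/-- The map on homotopy limits induced by a functor `p` between the indexing categories and a
natural transformation `p ⋙ X ⟶ Y`. -/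
def holimMap {C : Type w} [Category.{v} C] {D : Type w} [Category.{v} D] {X : C ⥤ SSet.{u}}
    {Y : D ⥤ SSet.{u}} (p : D ⥤ C) (α : p ⋙ X ⟶ Y) : holim X ⟶ holim Y where
  app n := TypeCat.ofHom fun x =>
    { app := fun d k s t =>
        (α.app d).app k (x.app (p.obj d) k ((nerveMap (Over.post p)).app k s) t)
      map_simplex := fun d k k' g s t => by
        have h := x.map_simplex (p.obj d) g ((nerveMap (Over.post p)).app k s) t
        have h' := NatTrans.naturality_apply (α.app d) g
          (x.app (p.obj d) k ((nerveMap (Over.post p)).app k s) t)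
        exact (congrArg ((α.app d).app k') h).trans h'
      map_object := fun {d d'} g k s t => by
        have h := x.map_object (p.map g) k ((nerveMap (Over.post p)).app k s) t
        have h' : (nerveMap (Over.post p)).app k ((nerveMap (Over.map g)).app k s) =
            (nerveMap (Over.map (p.map g))).app k ((nerveMap (Over.post p)).app k s) := by
          exact congrArg (fun F => (nerveMap F).app k s) (map_comp_post p g)
        have h'' := ConcreteCategory.congr_hom (NatTrans.congr_app (α.naturality g) k)
          (x.app (p.obj d) k ((nerveMap (Over.post p)).app k s) t)
        rw [h']
        exact (congrArg ((α.app d').app k) h).trans h'' }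
  naturality n n' h := by
    rfl

/-- The homotopy limit as a functor of the diagram. -/
def holimFunctor (C : Type w) [Category.{v} C] : (C ⥤ SSet.{u}) ⥤ SSet.{max w v u} where
  obj X := holim X
  map {X Y} α := holimMap (𝟭 C) α
  map_id X := by
    ext n x
    rfl
  map_comp {X Y Z} α β := by
    ext n x
    rfl

/-- A compatible family of maps `A ⟶ X c` sends each `n`-simplex of `A` to an `n`-simplex of the
homotopy limit of `X`. -/
def HolimSimplex.ofCone {C : Type w} [Category.{v} C] {X : C ⥤ SSet.{u}} {A : SSet.{u}}
    (f : ∀ c, A ⟶ X.obj c) (hf : ∀ {c c' : C} (g : c ⟶ c'), f c ≫ X.map g = f c')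
    {n : SimplexCategoryᵒᵖ} (a : A.obj n) : HolimSimplex X n where
  app c k _ t := (f c).app k (A.map t.op a)
  map_simplex c k k' g s t := by
    have h : A.map (g.unop ≫ t).op a = A.map g (A.map t.op a) := by
      rw [← Functor.map_comp_apply]
      rfl
    rw [h]
    exact NatTrans.naturality_apply (f c) g _
  map_object g k s t :=
    (ConcreteCategory.congr_hom (NatTrans.congr_app (hf g) k) _).symm

theorem HolimSimplex.ofCone_map {C : Type w} [Category.{v} C] {X : C ⥤ SSet.{u}} {A : SSet.{u}}
    (f : ∀ c, A ⟶ X.obj c) (hf : ∀ {c c' : C} (g : c ⟶ c'), f c ≫ X.map g = f c')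
    {n n' : SimplexCategoryᵒᵖ} (g : n ⟶ n') (a : A.obj n) :
    HolimSimplex.ofCone f hf (A.map g a) = (holim X).map g (HolimSimplex.ofCone f hf a) := by
  refine HolimSimplex.ext ?_
  funext c k s t
  change (f c).app k (A.map t.op (A.map g a)) = (f c).app k (A.map (t ≫ g.unop).op a)
  rw [← Functor.map_comp_apply]
  rfl

/-- The map into a homotopy limit over a small category induced by a compatible family of maps
`A ⟶ X d`. -/
def holimLift {D : Type} [SmallCategory D] {X : D ⥤ SSet.{u}} {A : SSet.{u}}
    (f : ∀ d, A ⟶ X.obj d) (hf : ∀ {d d' : D} (g : d ⟶ d'), f d ≫ X.map g = f d') :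
    A ⟶ holim X where
  app _ := TypeCat.ofHom fun a => HolimSimplex.ofCone f hf a
  naturality _ _ g := ConcreteCategory.hom_ext _ _ fun a => HolimSimplex.ofCone_map f hf g a

/-- The natural transformation into an objectwise homotopy limit induced by a compatible family of
maps. -/
def toHolim {C : Type w} [Category.{v} C] {D : Type} [SmallCategory D] {A : C ⥤ SSet.{u}}
    {X : C ⥤ D ⥤ SSet.{u}} (f : ∀ c d, A.obj c ⟶ (X.obj c).obj d)
    (hd : ∀ c {d d' : D} (g : d ⟶ d'), f c d ≫ (X.obj c).map g = f c d')
    (hc : ∀ {c c' : C} (g : c ⟶ c') d, A.map g ≫ f c' d = f c d ≫ (X.map g).app d) :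
    A ⟶ X ⋙ holimFunctor D where
  app c := holimLift (f c) (hd c)
  naturality c c' g := by
    refine NatTrans.ext (funext fun n => ConcreteCategory.hom_ext _ _ fun a =>
      HolimSimplex.ext (funext fun d => funext fun k => funext fun _ => funext fun t => ?_))
    have h := ConcreteCategory.congr_hom (NatTrans.congr_app (hc g d) k) ((A.obj c).map t.op a)
    refine Eq.trans ?_ h
    exact congrArg ((f c' d).app k) (NatTrans.naturality_apply (A.map g) t.op a).symm

/-! ### Homotopy fibers -/

/-- An `n`-simplex of the homotopy fiber of `f` over `b₀`: an `n`-simplex `a` of `A` with a path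
`Δ[n] × Δ[1] ⟶ B` from `f a` to the constant simplex at `b₀`. -/
@[ext]
structure HofiberSimplex {A B : SSet.{u}} (f : A ⟶ B) (b₀ : B _⦋0⦌) (n : SimplexCategoryᵒᵖ) where
  simplex : A.obj n
  path : SSet.stdSimplex.{u}.obj n.unop ⊗ Δ[1] ⟶ B
  path_zero : SSet.ι₀ ≫ path = SSet.yonedaEquiv.symm (f.app n simplex)
  path_one : SSet.ι₁ ≫ path = SSet.const b₀

/-- The homotopy fiber of `f : A ⟶ B` over `b₀`. -/
def hofiber {A B : SSet.{u}} (f : A ⟶ B) (b₀ : B _⦋0⦌) : SSet.{u} where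
  obj n := HofiberSimplex f b₀ n
  map {n n'} h := TypeCat.ofHom fun x =>
    { simplex := A.map h x.simplex
      path := SSet.stdSimplex.{u}.map h.unop ▷ Δ[1] ≫ x.path
      path_zero := by
        rw [SSet.ι₀_comp_assoc, x.path_zero, NatTrans.naturality_apply]
        exact SSet.yonedaEquiv_symm_naturality_left h.unop _
      path_one := by
        rw [SSet.ι₁_comp_assoc, x.path_one, SSet.comp_const] }
  map_id n := ConcreteCategory.hom_ext _ _ fun x => HofiberSimplex.ext (by simp) (by
    change SSet.stdSimplex.{u}.map (𝟙 n.unop) ▷ Δ[1] ≫ x.path = x.path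
    have h : SSet.stdSimplex.{u}.map (𝟙 n.unop) = 𝟙 _ := CategoryTheory.Functor.map_id _ _
    rw [h, id_whiskerRight, Category.id_comp])
  map_comp g h := ConcreteCategory.hom_ext _ _ fun x => HofiberSimplex.ext (by simp) (by
    change SSet.stdSimplex.{u}.map (h.unop ≫ g.unop) ▷ Δ[1] ≫ x.path =
      SSet.stdSimplex.{u}.map h.unop ▷ Δ[1] ≫ SSet.stdSimplex.{u}.map g.unop ▷ Δ[1] ≫ x.path
    have h' : SSet.stdSimplex.{u}.map (h.unop ≫ g.unop) =
        SSet.stdSimplex.{u}.map h.unop ≫ SSet.stdSimplex.{u}.map g.unop :=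
      CategoryTheory.Functor.map_comp _ _ _
    rw [h', comp_whiskerRight, Category.assoc])

/-- The map of homotopy fibers induced by a commutative square. -/
def hofiberMap {A B A' B' : SSet.{u}} {f : A ⟶ B} {f' : A' ⟶ B'} {b₀ : B _⦋0⦌} {b₀' : B' _⦋0⦌}
    (α : A ⟶ A') (β : B ⟶ B') (h : α ≫ f' = f ≫ β) (hb : β.app _ b₀ = b₀') :
    hofiber f b₀ ⟶ hofiber f' b₀' where
  app n := TypeCat.ofHom fun x =>
    { simplex := α.app n x.simplex
      path := x.path ≫ β
      path_zero := by
        rw [← Category.assoc, x.path_zero, SSet.yonedaEquiv_symm_comp]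
        have h' := ConcreteCategory.congr_hom (NatTrans.congr_app h n) x.simplex
        exact congrArg _ h'.symm
      path_one := by
        rw [← Category.assoc, x.path_one, ← hb, SSet.const_comp] }
  naturality n n' g := ConcreteCategory.hom_ext _ _ fun x =>
    HofiberSimplex.ext (NatTrans.naturality_apply α g x.simplex) (Category.assoc _ _ _)

/-- A compatible choice of basepoints in the values of a functor. -/
structure Basepoint {C : Type w} [Category.{v} C] (G : C ⥤ SSet.{u}) where
  pt (c : C) : (G.obj c) _⦋0⦌
  map_pt {c c' : C} (g : c ⟶ c') : (G.map g).app _ (pt c) = pt c'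

/-- The image of a choice of basepoints under a natural transformation. -/
def Basepoint.map {C : Type w} [Category.{v} C] {G G' : C ⥤ SSet.{u}} (x : Basepoint G)
    (τ : G ⟶ G') : Basepoint G' where
  pt c := (τ.app c).app _ (x.pt c)
  map_pt {c c'} g := by
    have h := ConcreteCategory.congr_hom (NatTrans.congr_app (τ.naturality g) (op ⦋0⦌)) (x.pt c)
    exact h.symm.trans (congrArg _ (x.map_pt g))

/-- The objectwise homotopy fiber of a natural transformation. -/
def hofiberFunctor {C : Type w} [Category.{v} C] {G G' : C ⥤ SSet.{u}} (τ : G ⟶ G')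
    (b : Basepoint G') : C ⥤ SSet.{u} where
  obj c := hofiber (τ.app c) (b.pt c)
  map g := hofiberMap (G.map g) (G'.map g) (τ.naturality g) (b.map_pt g)
  map_id c := by
    refine NatTrans.ext (funext fun n => ConcreteCategory.hom_ext _ _ fun x =>
      HofiberSimplex.ext ?_ ?_)
    · change (G.map (𝟙 c)).app n x.simplex = x.simplex
      simp
    · change x.path ≫ G'.map (𝟙 c) = x.path
      simp
  map_comp g h := by
    refine NatTrans.ext (funext fun n => ConcreteCategory.hom_ext _ _ fun x =>
      HofiberSimplex.ext ?_ ?_)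
    · change (G.map (g ≫ h)).app n x.simplex = (G.map h).app n ((G.map g).app n x.simplex)
      simp
    · change x.path ≫ G'.map (g ≫ h) = (x.path ≫ G'.map g) ≫ G'.map h
      simp

/-- The projection from the homotopy fiber to the source. -/
def hofiberProj {C : Type w} [Category.{v} C] {G G' : C ⥤ SSet.{u}} (τ : G ⟶ G')
    (b : Basepoint G') : hofiberFunctor τ b ⟶ G where
  app c := { app := fun n => TypeCat.ofHom fun x => x.simplex }

/-! ### Cubes -/

/-- The inclusion of the poset of non-empty subsets of `T` into the poset of all subsets. -/
def nonemptySubsets (T : Type) : {R : Finset T // R.Nonempty} ⥤ Finset T :=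
  Monotone.functor (f := Subtype.val) (fun _ _ h => h)

/-- The functor `holim_{R ≠ ∅} X(R)`, for a functor `X` to `T`-cubes. -/
def puncturedHolim {C : Type w} [Category.{v} C] {T : Type} (X : C ⥤ Finset T ⥤ SSet.{u}) :
    C ⥤ SSet.{u} :=
  (X ⋙ (Functor.whiskeringLeft _ _ SSet.{u}).obj (nonemptySubsets T)) ⋙ holimFunctor _

/-- The canonical map `X(∅) ⟶ holim_{R ≠ ∅} X(R)`, for a functor `X` to `T`-cubes. -/
def cubeMap {C : Type w} [Category.{v} C] {T : Type} (X : C ⥤ Finset T ⥤ SSet.{u}) :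
    X ⋙ (evaluation (Finset T) SSet.{u}).obj ∅ ⟶ puncturedHolim X :=
  toHolim (X := X ⋙ (Functor.whiskeringLeft _ _ SSet.{u}).obj (nonemptySubsets T))
    (fun c R => (X.obj c).map (homOfLE (Finset.empty_subset R.1)))
    (fun c _ _ _ => ((X.obj c).map_comp _ _).symm)
    (fun g R => ((X.map g).naturality (homOfLE (Finset.empty_subset R.1))).symm)

/-- The total homotopy fiber of a functor to `T`-cubes, based at `x`. -/
def tfiber {C : Type w} [Category.{v} C] {T : Type} (X : C ⥤ (Finset T ⥤ SSet.{u}))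
    (x : Basepoint (X ⋙ (evaluation (Finset T) SSet.{u}).obj ∅)) : C ⥤ SSet.{u} :=
  hofiberFunctor (cubeMap X) (x.map (cubeMap X))

/-! ### The Taylor multi-tower -/

/-- `V` is diffeomorphic to at most `k` disjoint open balls: it is the disjoint union of at most
`k` open sets, each of which is diffeomorphic to the open unit ball of `ℝᵈ`. -/
def IsDisjointBalls {d : ℕ} {H : Type w} [TopologicalSpace H]
    (I : ModelWithCorners ℝ (EuclideanSpace ℝ (Fin d)) H) {M : Type u} [TopologicalSpace M]
    [ChartedSpace H M] (k : ℤ) (V : Opens M) : Prop :=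
  ∃ r : ℕ, (r : ℤ) ≤ k ∧ ∃ B : Fin r → Opens M,
    (∀ a b, a ≠ b → Disjoint (B a) (B b)) ∧ V = ⨆ a, B a ∧
    ∀ a, Nonempty (Diffeomorph I (modelWithCornersSelf ℝ (EuclideanSpace ℝ (Fin d))) (B a)
      (⟨Metric.ball 0 1, Metric.isOpen_ball⟩ : Opens (EuclideanSpace ℝ (Fin d))) ∞)

/-- The poset `𝒪(P₁) × ⋯ × 𝒪(Pₘ)` of tuples of open sets. -/
def MultiOpen {m : ℕ} (P : Fin m → Type u) [∀ i, TopologicalSpace (P i)] : Type u :=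
  ∀ i, Opens (P i)

instance {m : ℕ} (P : Fin m → Type u) [∀ i, TopologicalSpace (P i)] :
    PartialOrder (MultiOpen P) :=
  inferInstanceAs (PartialOrder (∀ i, Opens (P i)))

instance {m : ℕ} (P : Fin m → Type u) [∀ i, TopologicalSpace (P i)] : OrderTop (MultiOpen P) :=
  inferInstanceAs (OrderTop (∀ i, Opens (P i)))

section

variable {m : ℕ} {d : Fin m → ℕ} {H : Fin m → Type w} [∀ i, TopologicalSpace (H i)]
  (I : ∀ i, ModelWithCorners ℝ (EuclideanSpace ℝ (Fin (d i))) (H i)) {P : Fin m → Type u}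
  [∀ i, TopologicalSpace (P i)] [∀ i, ChartedSpace (H i) (P i)]

/-- The poset `𝒪_k(U) = ∏ᵢ 𝒪_{kᵢ}(Uᵢ)`, where `𝒪_{kᵢ}(Uᵢ)` consists of the open subsets of `Uᵢ`
which are diffeomorphic to at most `kᵢ` disjoint open balls. It is empty if some `kᵢ` is
negative. -/
def BallOpen (k : Fin m → ℤ) (U : MultiOpen P) : Type u :=
  {V : MultiOpen P // V ≤ U ∧ ∀ i, IsDisjointBalls (I i) (k i) (V i)}

instance (k : Fin m → ℤ) (U : MultiOpen P) : PartialOrder (BallOpen I k U) :=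
  inferInstanceAs (PartialOrder {_V : MultiOpen P // _})

/-- The inclusion of `𝒪_k(U)` into the poset of all tuples of open sets. -/
def ballInclusion (k : Fin m → ℤ) (U : MultiOpen P) : BallOpen I k U ⥤ MultiOpen P :=
  Monotone.functor (f := Subtype.val) (fun _ _ h => h)

theorem IsDisjointBalls.mono {d : ℕ} {H : Type w} [TopologicalSpace H]
    {I : ModelWithCorners ℝ (EuclideanSpace ℝ (Fin d)) H} {M : Type u} [TopologicalSpace M]
    [ChartedSpace H M] {k k' : ℤ} (hk : k ≤ k') {V : Opens M} (h : IsDisjointBalls I k V) :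
    IsDisjointBalls I k' V := by
  obtain ⟨r, hr, h⟩ := h
  exact ⟨r, hr.trans hk, h⟩

/-- The inclusion `𝒪_k(U) ⊆ 𝒪_{k'}(U')` for `k ≤ k'` and `U ≤ U'`. -/
def ballMono {k k' : Fin m → ℤ} (hk : k ≤ k') {U U' : MultiOpen P} (hU : U ≤ U') :
    BallOpen I k U ⥤ BallOpen I k' U' :=
  Monotone.functor
    (f := fun V : BallOpen I k U =>
      (⟨V.1, V.2.1.trans hU, fun i => (V.2.2 i).mono (hk i)⟩ : BallOpen I k' U'))
    (fun _ _ h => h)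

/-- The value `T_k F(U) = holim_{V ∈ 𝒪_k(U)} F(V)`. -/
def taylorObj (F : (MultiOpen P)ᵒᵖ ⥤ SSet.{u}) (k : Fin m → ℤ) (U : MultiOpen P) : SSet.{u} :=
  holim ((ballInclusion I k U).op ⋙ F)

/-- The restriction map `T_{k'} F(U') ⟶ T_k F(U)` for `k ≤ k'` and `U ≤ U'`. -/
def taylorMap (F : (MultiOpen P)ᵒᵖ ⥤ SSet.{u}) {k k' : Fin m → ℤ} (hk : k ≤ k')
    {U U' : MultiOpen P} (hU : U ≤ U') : taylorObj I F k' U' ⟶ taylorObj I F k U :=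
  holimMap (ballMono I hk hU).op (𝟙 ((ballInclusion I k U).op ⋙ F))

theorem taylorMap_refl (F : (MultiOpen P)ᵒᵖ ⥤ SSet.{u}) (k : Fin m → ℤ) (U : MultiOpen P) :
    taylorMap I F (le_refl k) (le_refl U) = 𝟙 _ := by
  ext n x
  rfl

theorem taylorMap_comp (F : (MultiOpen P)ᵒᵖ ⥤ SSet.{u}) {k k' k'' : Fin m → ℤ} (hk : k ≤ k')
    (hk' : k' ≤ k'') {U U' U'' : MultiOpen P} (hU : U ≤ U') (hU' : U' ≤ U'') :
    taylorMap I F hk' hU' ≫ taylorMap I F hk hU =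
      taylorMap I F (hk.trans hk') (hU.trans hU') := by
  ext n x
  rfl

/-- The functor `T_k F` on tuples of open sets. -/
def taylor (F : (MultiOpen P)ᵒᵖ ⥤ SSet.{u}) (k : Fin m → ℤ) : (MultiOpen P)ᵒᵖ ⥤ SSet.{u} where
  obj U := taylorObj I F k U.unop
  map h := taylorMap I F (le_refl k) h.unop.le
  map_id U := taylorMap_refl I F k U.unop
  map_comp g h := (taylorMap_comp I F (le_refl k) (le_refl k) h.unop.le g.unop.le).symm

/-- The canonical map `T_{k'} F ⟶ T_k F` for `k ≤ k'`. -/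
def taylorRestrict (F : (MultiOpen P)ᵒᵖ ⥤ SSet.{u}) {k k' : Fin m → ℤ} (hk : k ≤ k') :
    taylor I F k' ⟶ taylor I F k where
  app U := taylorMap I F hk (le_refl U.unop)
  naturality U V h := by
    change taylorMap I F _ _ ≫ taylorMap I F _ _ = taylorMap I F _ _ ≫ taylorMap I F _ _
    rw [taylorMap_comp, taylorMap_comp]

/-- The canonical map `F(U) ⟶ T_k F(U)`, induced by the restrictions `F(U) ⟶ F(V)`. -/
def toTaylorObj (F : (MultiOpen P)ᵒᵖ ⥤ SSet.{u}) (k : Fin m → ℤ) (U : MultiOpen P) :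
    F.obj (op U) ⟶ taylorObj I F k U :=
  have hf : ∀ {V V' : (BallOpen I k U)ᵒᵖ} (g : V ⟶ V'),
      F.map (homOfLE V.unop.2.1).op ≫ ((ballInclusion I k U).op ⋙ F).map g =
        F.map (homOfLE V'.unop.2.1).op := fun _ => (F.map_comp _ _).symm
  { app _ := TypeCat.ofHom fun a => HolimSimplex.ofCone
      (X := (ballInclusion I k U).op ⋙ F) (fun V => F.map (homOfLE V.unop.2.1).op) hf a
    naturality _ _ g := ConcreteCategory.hom_ext _ _ fun a =>
      HolimSimplex.ofCone_map (X := (ballInclusion I k U).op ⋙ F)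
        (fun V => F.map (homOfLE V.unop.2.1).op) hf g a }

/-- The canonical map `F ⟶ T_k F`. -/
def toTaylor (F : (MultiOpen P)ᵒᵖ ⥤ SSet.{u}) (k : Fin m → ℤ) : F ⟶ taylor I F k where
  app U := toTaylorObj I F k U.unop
  naturality U U' h := by
    refine NatTrans.ext (funext fun n => ConcreteCategory.hom_ext _ _ fun a =>
      HolimSimplex.ext (funext fun V => funext fun l => funext fun _ => funext fun t => ?_))
    have hV : F.map h ≫ F.map (homOfLE V.unop.2.1).op =
        F.map (homOfLE (V.unop.2.1.trans h.unop.le)).op := (F.map_comp _ _).symm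
    have h' := ConcreteCategory.congr_hom (NatTrans.congr_app hV l) ((F.obj U).map t.op a)
    refine Eq.trans ?_ h'
    exact congrArg ((F.map (homOfLE V.unop.2.1).op).app l)
      (NatTrans.naturality_apply (F.map h) t.op a).symm

/-- The diagram of functors `a ↦ T_{p(a)} F`, for `p` an order-reversing family of degrees. -/
def taylorDiagram (F : (MultiOpen P)ᵒᵖ ⥤ SSet.{u}) {D : Type} [SmallCategory D]
    (p : D → Fin m → ℤ) (hp : ∀ {a b : D}, (a ⟶ b) → p b ≤ p a) :
    (MultiOpen P)ᵒᵖ ⥤ D ⥤ SSet.{u} where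
  obj U :=
    { obj a := taylorObj I F (p a) U.unop
      map g := taylorMap I F (hp g) (le_refl U.unop)
      map_id a := taylorMap_refl I F (p a) U.unop
      map_comp f g := (taylorMap_comp I F (hp g) (hp f) (le_refl _) (le_refl _)).symm }
  map h :=
    { app a := taylorMap I F (le_refl (p a)) h.unop.le
      naturality a b g := by
        rw [taylorMap_comp, taylorMap_comp] }
  map_id U := NatTrans.ext (funext fun a => taylorMap_refl I F (p a) U.unop)
  map_comp g h := NatTrans.ext (funext fun a =>
    (taylorMap_comp I F (le_refl (p a)) (le_refl (p a)) h.unop.le g.unop.le).symm)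

/-- The multi-tower `k ↦ T_k F`, restricted to the poset of tuples `k` of non-negative integers
with `k < j`, that is, `k ≤ j` and `kᵢ < jᵢ` for some `i`. -/
def towerBelow (F : (MultiOpen P)ᵒᵖ ⥤ SSet.{u}) (j : Fin m → ℕ) :
    (MultiOpen P)ᵒᵖ ⥤ {k : Fin m → ℕ // k < j}ᵒᵖ ⥤ SSet.{u} :=
  taylorDiagram I F (fun k i => (k.unop.1 i : ℤ)) (fun g i => Int.ofNat_le.2 (g.unop.le i))

/-- The functor `holim_{k < j} T_k F`. -/
def holimBelow (F : (MultiOpen P)ᵒᵖ ⥤ SSet.{u}) (j : Fin m → ℕ) : (MultiOpen P)ᵒᵖ ⥤ SSet.{u} :=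
  towerBelow I F j ⋙ holimFunctor _

/-- The canonical map `T_j F ⟶ holim_{k < j} T_k F`. -/
def toHolimBelow (F : (MultiOpen P)ᵒᵖ ⥤ SSet.{u}) (j : Fin m → ℕ) :
    taylor I F (fun i => (j i : ℤ)) ⟶ holimBelow I F j :=
  toHolim (X := towerBelow I F j)
    (fun U k => taylorMap I F (fun i => Int.ofNat_le.2 (k.unop.2.le i)) (le_refl U.unop))
    (fun _ _ _ _ => taylorMap_comp I F _ _ _ _)
    (fun _ _ => (taylorMap_comp I F _ _ _ _).trans (taylorMap_comp I F _ _ _ _).symm)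

/-- The basepoints of the values of `F` which are induced by a basepoint of `F(P₁, …, Pₘ)`. -/
def basepointOfTop {F : (MultiOpen P)ᵒᵖ ⥤ SSet.{u}} (x₀ : (F.obj (op ⊤)) _⦋0⦌) : Basepoint F where
  pt U := (F.map (homOfLE (le_top : U.unop ≤ ⊤)).op).app _ x₀
  map_pt {U V} g := by
    have h : F.map (homOfLE (le_top : U.unop ≤ ⊤)).op ≫ F.map g =
        F.map (homOfLE (le_top : V.unop ≤ ⊤)).op := (F.map_comp _ _).symm
    exact ConcreteCategory.congr_hom (NatTrans.congr_app h (op ⦋0⦌)) x₀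

/-- The layer `L_j F`, the homotopy fiber of `T_j F ⟶ holim_{k < j} T_k F` over the basepoint. -/
def layer (F : (MultiOpen P)ᵒᵖ ⥤ SSet.{u}) (j : Fin m → ℕ) (x₀ : (F.obj (op ⊤)) _⦋0⦌) :
    (MultiOpen P)ᵒᵖ ⥤ SSet.{u} :=
  hofiberFunctor (toHolimBelow I F j)
    (((basepointOfTop x₀).map (toTaylor I F _)).map (toHolimBelow I F j))

/-- The tuple `j_R`, obtained from `j` by decreasing the coordinates in `R` by one. -/
def lower (j : Fin m → ℕ) (R : Finset (Fin m)) (i : Fin m) : ℤ :=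
  if i ∈ R then (j i : ℤ) - 1 else j i

theorem lower_anti (j : Fin m → ℕ) {R R' : Finset (Fin m)} (h : R ≤ R') :
    lower j R' ≤ lower j R := by
  intro i
  by_cases hi : i ∈ R
  · have hi' : i ∈ R' := h hi
    simp [lower, hi, hi']
  · by_cases hi' : i ∈ R' <;> simp [lower, hi, hi']

theorem lower_empty_le (j : Fin m → ℕ) : lower j ∅ ≤ fun i => (j i : ℤ) := by
  intro i
  simp [lower]

/-- The `m`-cube `R ↦ T_{j_R} F` of functors. -/
def taylorCube (F : (MultiOpen P)ᵒᵖ ⥤ SSet.{u}) (j : Fin m → ℕ) :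
    (MultiOpen P)ᵒᵖ ⥤ Finset (Fin m) ⥤ SSet.{u} :=
  taylorDiagram I F (lower j) (fun g => lower_anti j g.le)

/-- The basepoints of the initial vertex `T_{j_∅} F` of the cube. -/
def taylorCubeBasepoint (F : (MultiOpen P)ᵒᵖ ⥤ SSet.{u}) (j : Fin m → ℕ)
    (x₀ : (F.obj (op ⊤)) _⦋0⦌) :
    Basepoint (taylorCube I F j ⋙ (evaluation (Finset (Fin m)) SSet.{u}).obj ∅) :=
  (basepointOfTop x₀).map (toTaylor I F (lower j ∅))

/-- The canonical map from `T_j F` to the initial vertex `T_{j_∅} F` of the cube; it is the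
identity up to the equality `j_∅ = j`. -/
def toTaylorCube (F : (MultiOpen P)ᵒᵖ ⥤ SSet.{u}) (j : Fin m → ℕ) :
    taylor I F (fun i => (j i : ℤ)) ⟶
      taylorCube I F j ⋙ (evaluation (Finset (Fin m)) SSet.{u}).obj ∅ :=
  taylorRestrict I F (lower_empty_le j)

end

end ManifoldCalculus

open ManifoldCalculus

namespace ManifoldCalculus

/-! ### The homotopy of homotopy limits induced by a deflation of the indexing category -/

/-! To `k < j` assign the non-empty set `D(k)` of coordinates with `k i < j i` (`decreased`). Then
`k ≤ j_{D(k)}`, and `D(j_R) = R` whenever `j` is positive on `R`. In the opposite order this makes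
those `R` a coreflective subposet of the tuples below `j`, and restricting a homotopy limit to it is
an equivalence. If `j i = 0` for some `i ∈ R`, then `j_R` has a negative entry and `T_{j_R} F` is a
point; such `R` form an upward closed family, so they contribute nothing to the punctured homotopy
limit.

Both directions are explicit: restriction along `R ↦ j_R` gives `toPunctured`, and `k ↦ D(k)` gives
`fromPunctured`. One composite is the identity (`fromPunctured_toPunctured`). The other is induced
by the deflation `k ↦ j_{D(k)}` (`toPunctured_fromPunctured`) and is homotopic to the identity by
deforming chains in the slices (`holimDeflationHomotopy`). Simplices coming from `T_j F` do not
depend on the chain, so the homotopy is stationary on them (`toHolimBelow_puncturedHomotopy`). The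
result is a deformation retraction relative to `T_j F`, which induces an equivalence of homotopy
fibers over basepoints coming from `T_j F` (`isEquivalence_hofiberMap`). -/

/-- Given chains `f ≤ g` in a thin category and a monotone `v : J → Fin 2`, the chain which agrees
with `f` where `v = 0` and with `g` where `v = 1`. -/
noncomputable def spliceFunctor {J : Type w'} [Preorder J] {A : Type w} [Category.{v} A] [Quiver.IsThin A]
    {f g : J ⥤ A} (α : f ⟶ g) (p : J →o Fin 2) : J ⥤ A where
  obj i := if p i = 0 then f.obj i else g.obj i
  -- Any arrow will do, since `A` is thin. Monotonicity of `p` excludes the step from 1 to 0, the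
  -- only one for which no arrow is available.
  map {i i'} h := Nonempty.some <| by
    have hp : p i ≤ p i' := p.monotone h.le
    by_cases h₀ : p i = 0 <;> by_cases h₁ : p i' = 0
    · rw [if_pos h₀, if_pos h₁]
      exact ⟨f.map h⟩
    · rw [if_pos h₀, if_neg h₁]
      exact ⟨f.map h ≫ α.app i'⟩
    · exact absurd (Fin.le_zero_iff.1 (h₁ ▸ hp)) h₀
    · rw [if_neg h₀, if_neg h₁]
      exact ⟨g.map h⟩
  map_id _ := Subsingleton.elim _ _
  map_comp _ _ := Subsingleton.elim _ _

/-! ### Deforming chains in the slices -/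

section Deflation

variable {C : Type w} [Category.{v} C] [Quiver.IsThin C]

instance isThin_over (c : C) : Quiver.IsThin (Over c) := fun _ _ =>
  ⟨fun _ _ => Over.OverMorphism.ext (Subsingleton.elim _ _)⟩

variable {e : C ⥤ C} (ε : e ⟶ 𝟭 C)

/-- The endofunctor `(c' ⟶ c) ↦ (e c' ⟶ c' ⟶ c)` of `C / c`. -/
def overDeflation (c : C) : Over c ⥤ Over c where
  obj Y := Over.mk (ε.app Y.left ≫ Y.hom)
  map h := Over.homMk (e.map h.left) (Subsingleton.elim _ _)
  map_id _ := Subsingleton.elim _ _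
  map_comp _ _ := Subsingleton.elim _ _

/-- The natural map from `overDeflation ε c` to the identity. -/
def overDeflationCounit (c : C) : overDeflation ε c ⟶ 𝟭 (Over c) where
  app Y := Over.homMk (ε.app Y.left) rfl
  naturality _ _ _ := Subsingleton.elim _ _

/-- The simplicial homotopy `N(C / c) × Δ[1] ⟶ N(C / c)` from `overDeflation ε c` to the
identity. -/
noncomputable def nerveDeflation (c : C) {k : SimplexCategoryᵒᵖ} (s : (nerve (Over c)).obj k)
    (p : k.unop ⟶ ⦋1⦌) : (nerve (Over c)).obj k :=
  spliceFunctor (f := s ⋙ overDeflation ε c) (g := s)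
    (Functor.whiskerLeft s (overDeflationCounit ε c)) p.toOrderHom

/-- Splicing is done vertex by vertex, and a simplex of the nerve of a thin category is determined
by its vertices. -/
theorem nerveDeflation_map (c : C) {k k' : SimplexCategoryᵒᵖ} (g : k ⟶ k')
    (s : (nerve (Over c)).obj k) (p : k.unop ⟶ ⦋1⦌) :
    nerveDeflation ε c ((nerve (Over c)).map g s) (g.unop ≫ p) =
      (nerve (Over c)).map g (nerveDeflation ε c s p) :=
  nerve.ext_of_isThin rfl

theorem nerveDeflation_over_map {c c' : C} (g : c ⟶ c') {k : SimplexCategoryᵒᵖ}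
    (s : (nerve (Over c)).obj k) (p : k.unop ⟶ ⦋1⦌) :
    nerveDeflation ε c' ((nerveMap (Over.map g)).app k s) p =
      (nerveMap (Over.map g)).app k (nerveDeflation ε c s p) := by
  refine nerve.ext_of_isThin (funext fun i => ?_)
  change (if p.toOrderHom i = 0 then (overDeflation ε c').obj ((Over.map g).obj (s.obj i))
      else (Over.map g).obj (s.obj i)) =
    (Over.map g).obj (if p.toOrderHom i = 0 then (overDeflation ε c).obj (s.obj i) else s.obj i)
  split_ifs
  · exact congrArg Over.mk (Category.assoc _ _ _).symm
  · rfl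

/-- On vertices this is the naturality square of `ε`, automatic in a thin category. The right-hand
side has the shape to which `map_object` applies along `ε.app c`. -/
theorem nerveDeflation_zero {c : C} {k : SimplexCategoryᵒᵖ} (s : (nerve (Over c)).obj k)
    (p : k.unop ⟶ ⦋1⦌) (hp : ∀ i, p.toOrderHom i = 0) :
    nerveDeflation ε c s p =
      (nerveMap (Over.map (ε.app c))).app k ((nerveMap (Over.post e)).app k s) := by
  refine nerve.ext_of_isThin (funext fun i => (if_pos (hp i)).trans ?_)
  exact congrArg (Over.mk (Y := e.obj (s.obj i).left)) (Subsingleton.elim _ _)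

theorem nerveDeflation_one {c : C} {k : SimplexCategoryᵒᵖ} (s : (nerve (Over c)).obj k)
    (p : k.unop ⟶ ⦋1⦌) (hp : ∀ i, p.toOrderHom i = 1) : nerveDeflation ε c s p = s :=
  nerve.ext_of_isThin (funext fun i => if_neg (by rw [hp i]; exact one_ne_zero))

end Deflation

/-! ### The induced homotopy on the homotopy limit -/

section DeflationHomotopy

variable {C : Type} [SmallCategory C] [Quiver.IsThin C] {e : C ⥤ C} (ε : e ⟶ 𝟭 C)
  (X : C ⥤ SSet.{u})

/-- The endomorphism of `holim X` induced by an endofunctor `e` with a natural map to the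
identity. -/
def holimDeflation : holim X ⟶ holim X :=
  holimMap e (Functor.whiskerRight ε X)

/-- The homotopy from `holimDeflation ε X` to the identity. -/
noncomputable def holimDeflationMap : holim X ⊗ Δ[1] ⟶ holim X where
  app n := TypeCat.ofHom fun x =>
    { app := fun c k s t =>
        -- Composing `t` with the simplex of `Δ[1]` colours the vertices of `s`: those over 0 are
        -- deflated, those over 1 are kept.
        x.1.app c k (nerveDeflation ε c s (t ≫ SSet.stdSimplex.objEquiv x.2)) t
      map_simplex := fun c k k' g s t => by
        rw [Category.assoc, nerveDeflation_map, x.1.map_simplex]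
      map_object := fun g k s t => by
        rw [nerveDeflation_over_map, x.1.map_object] }
  naturality n n' g := by
    refine ConcreteCategory.hom_ext _ _ fun x => HolimSimplex.ext ?_
    funext c k s t
    change x.1.app c k (nerveDeflation ε c s (t ≫ g.unop ≫ SSet.stdSimplex.objEquiv x.2))
      (t ≫ g.unop) = x.1.app c k
        (nerveDeflation ε c s ((t ≫ g.unop) ≫ SSet.stdSimplex.objEquiv x.2)) (t ≫ g.unop)
    rw [Category.assoc]

/-- `holimDeflation ε X` is homotopic to the identity. -/
noncomputable def holimDeflationHomotopy : SSet.Homotopy (holimDeflation ε X) (𝟙 (holim X)) where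
  h := holimDeflationMap ε X
  h₀ := by
    refine NatTrans.ext (funext fun n => ConcreteCategory.hom_ext _ _ fun x => HolimSimplex.ext ?_)
    funext c k s t
    refine Eq.trans ?_ (x.map_object (ε.app c) k _ t)
    exact congrArg (fun s => x.app c k s t) (nerveDeflation_zero ε s _ fun _ => rfl)
  h₁ := by
    refine NatTrans.ext (funext fun n => ConcreteCategory.hom_ext _ _ fun x => HolimSimplex.ext ?_)
    funext c k s t
    exact congrArg (fun s => x.app c k s t) (nerveDeflation_one ε s _ fun _ => rfl)
  rel := by
    refine NatTrans.ext (funext fun n => ConcreteCategory.hom_ext _ _ fun x => ?_)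
    -- The homotopy is relative to the empty subcomplex, so there is nothing to check.
    exact False.elim x.1.2

end DeflationHomotopy

/-! ### Invariance of homotopy fibers -/

section Hofiber

variable {A B A' B' : SSet.{u}} {f : A ⟶ B} {f' : A' ⟶ B'}

/-- A homotopy of maps `B ⟶ B` from `β` to the identity which is constant on `A` induces a homotopy
of maps of homotopy fibers. -/
noncomputable def hofiberHomotopyMap {β : B ⟶ B} (H : SSet.Homotopy β (𝟙 B))
    (hH : f ▷ Δ[1] ≫ H.h = CartesianMonoidalCategory.fst _ _ ≫ f) (a₀ : A _⦋0⦌) :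
    hofiber f (f.app _ a₀) ⊗ Δ[1] ⟶ hofiber f (f.app _ a₀) where
  app n := TypeCat.ofHom fun x =>
    { simplex := x.1.simplex
      -- `H` is applied pointwise along the path, its time parameter being independent of the path
      -- parameter.
      path := CartesianMonoidalCategory.lift x.1.path
        (CartesianMonoidalCategory.fst _ _ ≫ SSet.yonedaEquiv.symm x.2) ≫ H.h
      path_zero := by
        have h : SSet.ι₀ ≫ CartesianMonoidalCategory.lift x.1.path
            (CartesianMonoidalCategory.fst _ _ ≫ SSet.yonedaEquiv.symm x.2) =
            CartesianMonoidalCategory.lift (SSet.yonedaEquiv.symm x.1.simplex)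
              (SSet.yonedaEquiv.symm x.2) ≫ f ▷ Δ[1] := by
          rw [CartesianMonoidalCategory.comp_lift, x.1.path_zero, SSet.ι₀_fst_assoc,
            CartesianMonoidalCategory.lift_whiskerRight, SSet.yonedaEquiv_symm_comp]
        rw [← Category.assoc, h, Category.assoc, hH, CartesianMonoidalCategory.lift_fst_assoc,
          SSet.yonedaEquiv_symm_comp]
      path_one := by
        -- The far end of the path is `f a₀`; lying in the image of `f`, it too is fixed by `H`.
        have h : SSet.ι₁ ≫ CartesianMonoidalCategory.lift x.1.path
            (CartesianMonoidalCategory.fst _ _ ≫ SSet.yonedaEquiv.symm x.2) =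
            CartesianMonoidalCategory.lift (SSet.const a₀)
              (SSet.yonedaEquiv.symm x.2) ≫ f ▷ Δ[1] := by
          rw [CartesianMonoidalCategory.comp_lift, x.1.path_one, SSet.ι₁_fst_assoc,
            CartesianMonoidalCategory.lift_whiskerRight, SSet.const_comp]
        rw [← Category.assoc, h, Category.assoc, hH, CartesianMonoidalCategory.lift_fst_assoc,
          SSet.const_comp] }
  naturality n n' g := by
    refine ConcreteCategory.hom_ext _ _ fun x => HofiberSimplex.ext rfl ?_
    change CartesianMonoidalCategory.lift (SSet.stdSimplex.{u}.map g.unop ▷ Δ[1] ≫ x.1.path)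
        (CartesianMonoidalCategory.fst _ _ ≫ SSet.yonedaEquiv.symm (Δ[1].map g x.2)) ≫ H.h =
      SSet.stdSimplex.{u}.map g.unop ▷ Δ[1] ≫ CartesianMonoidalCategory.lift x.1.path
        (CartesianMonoidalCategory.fst _ _ ≫ SSet.yonedaEquiv.symm x.2) ≫ H.h
    rw [← Category.assoc, CartesianMonoidalCategory.comp_lift,
      CartesianMonoidalCategory.whiskerRight_fst_assoc]
    congr 3

/-- The map of homotopy fibers induced by `β` is homotopic to the identity. -/
noncomputable def hofiberHomotopy {β : B ⟶ B} (H : SSet.Homotopy β (𝟙 B))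
    (hH : f ▷ Δ[1] ≫ H.h = CartesianMonoidalCategory.fst _ _ ≫ f) (a₀ : A _⦋0⦌)
    (h : 𝟙 A ≫ f = f ≫ β) (hb : β.app _ (f.app _ a₀) = f.app _ a₀) :
    SSet.Homotopy (hofiberMap (𝟙 A) β h hb) (𝟙 (hofiber f (f.app _ a₀))) where
  h := hofiberHomotopyMap H hH a₀
  h₀ := by
    refine NatTrans.ext (funext fun n => ConcreteCategory.hom_ext _ _ fun x =>
      HofiberSimplex.ext (f := f) ?_ ?_)
    · rfl
    · exact congrArg (x.path ≫ ·) H.h₀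
  h₁ := by
    refine NatTrans.ext (funext fun n => ConcreteCategory.hom_ext _ _ fun x =>
      HofiberSimplex.ext (f := f) ?_ ?_)
    · rfl
    · exact (congrArg (x.path ≫ ·) H.h₁).trans (Category.comp_id _)
  rel := by
    refine NatTrans.ext (funext fun n => ConcreteCategory.hom_ext _ _ fun x => ?_)
    exact False.elim x.1.2

theorem Homotopic.refl {X Y : SSet.{u}} (f : X ⟶ Y) : Homotopic f f :=
  Relation.EqvGen.refl f

theorem Homotopic.of_homotopy {X Y : SSet.{u}} {f g : X ⟶ Y} (H : SSet.Homotopy f g) :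
    Homotopic f g :=
  Relation.EqvGen.rel _ _ ⟨H⟩

/-- The map of homotopy fibers over an isomorphism `A ≅ A'` and a deformation retraction
`β : B ⟶ B'` whose homotopy is constant on `A` is an equivalence. -/
theorem isEquivalence_hofiberMap (α : A ≅ A') (β : B ⟶ B') (β' : B' ⟶ B)
    (h : α.hom ≫ f' = f ≫ β) (h' : α.inv ≫ f = f' ≫ β') (hβ : β' ≫ β = 𝟙 B')
    (H : SSet.Homotopy (β ≫ β') (𝟙 B))
    (hH : f ▷ Δ[1] ≫ H.h = CartesianMonoidalCategory.fst _ _ ≫ f) (a₀ : A _⦋0⦌) {b₀' : B' _⦋0⦌}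
    (hb : β.app _ (f.app _ a₀) = b₀') :
    IsEquivalence (hofiberMap (b₀ := f.app _ a₀) α.hom β h hb) := by
  -- The two squares force `β ≫ β'` to fix `f`, so it acts on the homotopy fiber over the same
  -- basepoint.
  have hf : 𝟙 A ≫ f = f ≫ β ≫ β' := by
    rw [← reassoc_of% h, ← h', Iso.hom_inv_id_assoc, Category.id_comp]
  have hb₂ : (β ≫ β').app _ (f.app _ a₀) = f.app _ a₀ :=
    (ConcreteCategory.congr_hom (NatTrans.congr_app hf (op ⦋0⦌)) a₀).symm
  have hb' : β'.app _ b₀' = f.app _ a₀ := (congrArg _ hb.symm).trans hb₂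
  refine ⟨hofiberMap α.inv β' h' hb', ?_, ?_⟩
  · have hc : hofiberMap (b₀ := f.app _ a₀) α.hom β h hb ≫ hofiberMap α.inv β' h' hb' =
        hofiberMap (𝟙 A) (β ≫ β') hf hb₂ := by
      refine NatTrans.ext (funext fun n => ConcreteCategory.hom_ext _ _ fun x =>
        HofiberSimplex.ext ?_ (Category.assoc _ _ _))
      exact ConcreteCategory.congr_hom (NatTrans.congr_app α.hom_inv_id n) x.simplex
    rw [hc]
    exact .of_homotopy (hofiberHomotopy H hH a₀ hf hb₂)
  · have hc : hofiberMap α.inv β' h' hb' ≫ hofiberMap (b₀ := f.app _ a₀) α.hom β h hb = 𝟙 _ := by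
      refine NatTrans.ext (funext fun n => ConcreteCategory.hom_ext _ _ fun x =>
        HofiberSimplex.ext ?_ ?_)
      · exact ConcreteCategory.congr_hom (NatTrans.congr_app α.inv_hom_id n) x.simplex
      · exact (Category.assoc _ _ _).trans ((congrArg (x.path ≫ ·) hβ).trans (Category.comp_id _))
    rw [hc]
    exact .refl _

end Hofiber

/-- The map of objectwise homotopy fibers induced by a commutative square of natural
transformations. -/
def hofiberFunctorMap {C : Type w} [Category.{v} C] {G G' K K' : C ⥤ SSet.{u}} {τ : G ⟶ G'}
    {τ' : K ⟶ K'} (α : G ⟶ K) (β : G' ⟶ K') (h : α ≫ τ' = τ ≫ β) {b : Basepoint G'}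
    {b' : Basepoint K'} (hb : ∀ c, (β.app c).app _ (b.pt c) = b'.pt c) :
    hofiberFunctor τ b ⟶ hofiberFunctor τ' b' where
  app c := hofiberMap (α.app c) (β.app c) (NatTrans.congr_app h c) (hb c)
  naturality c c' g := by
    refine NatTrans.ext (funext fun n => ConcreteCategory.hom_ext _ _ fun x =>
      HofiberSimplex.ext (f := τ'.app c') ?_ ?_)
    · exact ConcreteCategory.congr_hom (NatTrans.congr_app (α.naturality g) n) x.simplex
    · change (x.path ≫ G'.map g) ≫ β.app c' = (x.path ≫ β.app c) ≫ K'.map g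
      rw [Category.assoc, Category.assoc, β.naturality]

/-! ### Comparing the posets `{k < j}` and `{R ≠ ∅}` -/

/-- The structure arrow carries no information in a thin category, so chains in a slice can be
compared through their underlying objects. -/
theorem over_eq_of_left_eq {C : Type w} [Category.{v} C] [Quiver.IsThin C] {c : C} {Y Z : Over c}
    (h : Y.left = Z.left) : Y = Z := by
  obtain ⟨l, ⟨⟨⟩⟩, f⟩ := Y
  obtain ⟨l', ⟨⟨⟩⟩, f'⟩ := Z
  obtain rfl : l = l' := h
  obtain rfl : f = f' := Subsingleton.elim (α := l ⟶ c) f f'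
  rfl

instance isThin_op {C : Type w} [Category.{v} C] [Quiver.IsThin C] : Quiver.IsThin Cᵒᵖ :=
  fun _ _ => ⟨fun _ _ => Quiver.Hom.unop_inj (Subsingleton.elim _ _)⟩

section Posets

variable {m : ℕ} (j : Fin m → ℕ)

/-- The poset of non-empty subsets of `{1, …, m}`. -/
abbrev NonemptySubset (m : ℕ) : Type := {R : Finset (Fin m) // R.Nonempty}

/-- The opposite of the poset of tuples `k < j`. -/
abbrev Below : Type := {k : Fin m → ℕ // k < j}ᵒᵖ

/-- The tuple `j_R` as an element of the poset of tuples `k < j`, for a non-empty subset `R` on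
which `j` is positive. -/
def belowOfSubset (R : NonemptySubset m) (hR : ∀ i ∈ R.1, 0 < j i) : Below j :=
  op ⟨fun i => if i ∈ R.1 then j i - 1 else j i, by
    -- The subtraction is truncated; `hR` makes it a genuine decrease, and a member of `R` provides
    -- strictness.
    obtain ⟨i₀, hi₀⟩ := R.2
    refine Pi.lt_def.2 ⟨fun i => ?_, i₀, ?_⟩
    · dsimp only
      split_ifs <;> omega
    · have := hR i₀ hi₀
      simp only [hi₀, if_true]
      omega⟩

theorem belowOfSubset_le {R R' : NonemptySubset m} (h : R ≤ R') (hR : ∀ i ∈ R.1, 0 < j i)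
    (hR' : ∀ i ∈ R'.1, 0 < j i) :
    (belowOfSubset j R' hR').unop ≤ (belowOfSubset j R hR).unop := by
  intro i
  have hi : i ∈ R.1 → i ∈ R'.1 := fun hi => h hi
  change (if i ∈ R'.1 then j i - 1 else j i) ≤ (if i ∈ R.1 then j i - 1 else j i)
  split_ifs <;> first | omega | tauto

/-- The morphism `j_R ⟶ j_{R'}` for `R ⊆ R'`. -/
def belowHom {R R' : NonemptySubset m} (h : R ≤ R') {hR : ∀ i ∈ R.1, 0 < j i}
    {hR' : ∀ i ∈ R'.1, 0 < j i} : belowOfSubset j R hR ⟶ belowOfSubset j R' hR' :=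
  (homOfLE (belowOfSubset_le j h hR hR')).op

/-- The two tuples in fact coincide; the inequality suffices to obtain a restriction map and avoids
transport along an equality of degrees. -/
theorem lower_le_belowOfSubset (R : NonemptySubset m) (hR : ∀ i ∈ R.1, 0 < j i) :
    lower j R.1 ≤ fun i => (((belowOfSubset j R hR).unop.1 i : ℕ) : ℤ) := by
  intro i
  change (if i ∈ R.1 then (j i : ℤ) - 1 else j i) ≤
    ((if i ∈ R.1 then j i - 1 else j i : ℕ) : ℤ)
  split_ifs <;> omega

/-- The set of coordinates in which `k < j` is smaller than `j`. -/
def decreased : Below j ⥤ NonemptySubset m where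
  obj k := ⟨Finset.univ.filter fun i => k.unop.1 i < j i, by
    obtain ⟨i, hi⟩ := (Pi.lt_def.1 k.unop.2).2
    exact ⟨i, by simpa using hi⟩⟩
  map {k k'} g := homOfLE fun i hi => by
    have h : k'.unop.1 i ≤ k.unop.1 i := g.unop.le i
    simp only [Finset.mem_filter, Finset.mem_univ, true_and] at hi ⊢
    exact h.trans_lt hi
  map_id _ := Subsingleton.elim _ _
  map_comp _ _ := Subsingleton.elim _ _

theorem mem_decreased {k : Below j} {i : Fin m} :
    i ∈ ((decreased j).obj k).1 ↔ k.unop.1 i < j i := by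
  simp [decreased]

theorem pos_of_mem_decreased (k : Below j) : ∀ i ∈ ((decreased j).obj k).1, 0 < j i :=
  fun _ hi => Nat.zero_lt_of_lt ((mem_decreased j).1 hi)

/-- An entry smaller than `j i` is at most `j i - 1`, and every other entry equals `j i`. This
yields the maps `T_{j_{D(k)}} F ⟶ T_k F`. -/
theorem le_lower_decreased (k : Below j) :
    (fun i => (k.unop.1 i : ℤ)) ≤ lower j ((decreased j).obj k).1 := by
  intro i
  have h : k.unop.1 i ≤ j i := k.unop.2.le i
  have hi := mem_decreased j (k := k) (i := i)
  unfold lower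
  dsimp only
  split_ifs with h' <;> rw [hi] at h' <;> omega

/-- Positivity is essential: where `j i = 0`, truncated subtraction would leave the coordinate
unchanged. -/
theorem decreased_belowOfSubset (R : NonemptySubset m) (hR : ∀ i ∈ R.1, 0 < j i) :
    (decreased j).obj (belowOfSubset j R hR) = R := by
  refine Subtype.ext (Finset.ext fun i => (mem_decreased j).trans ?_)
  change (if i ∈ R.1 then j i - 1 else j i) < j i ↔ i ∈ R.1
  split_ifs with hi
  · have := hR i hi
    simp only [hi, iff_true]
    omega
  · simp [hi]

/-- The endofunctor `k ↦ j_R` of the poset of tuples `k < j`, where `R` is the set of coordinates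
in which `k` is smaller than `j`. -/
def belowDeflation : Below j ⥤ Below j where
  obj k := belowOfSubset j ((decreased j).obj k) (pos_of_mem_decreased j k)
  map g := belowHom j ((decreased j).map g).le
  map_id _ := Subsingleton.elim _ _
  map_comp _ _ := Subsingleton.elim _ _

theorem le_belowDeflation (k : Below j) : k.unop ≤ ((belowDeflation j).obj k).unop := fun i =>
  Int.ofNat_le.1 <| le_trans (le_lower_decreased j k i)
    (lower_le_belowOfSubset j ((decreased j).obj k) (pos_of_mem_decreased j k) i)

/-- The natural map from `belowDeflation j` to the identity. -/
def belowDeflationCounit : belowDeflation j ⟶ 𝟭 (Below j) where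
  app k := (homOfLE (le_belowDeflation j k)).op
  naturality _ _ _ := Subsingleton.elim _ _

/-- The functor `R' ↦ j_{R'}` on the poset of non-empty subsets of `R`, if `j` is positive
on `R`. -/
def overBelow (R : NonemptySubset m) (hR : ∀ i ∈ R.1, 0 < j i) :
    Over R ⥤ Over (belowOfSubset j R hR) where
  -- Positivity passes to subsets of `R`, so the whole slice maps to tuples below `j` even though `R
  -- ↦ j_R` is not defined everywhere.
  obj Y := Over.mk (Y := belowOfSubset j Y.left fun i hi => hR i (Y.hom.le hi))
    (belowHom j Y.hom.le)
  map {Y Z} g := Over.homMk (belowHom j g.left.le (hR := fun i hi => hR i (Y.hom.le hi))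
    (hR' := fun i hi => hR i (Z.hom.le hi))) (Subsingleton.elim _ _)
  map_id _ := Subsingleton.elim _ _
  map_comp _ _ := Subsingleton.elim _ _

end Posets

/-! ### Mutually inverse maps between the two homotopy limits -/

section Comparison

variable {m : ℕ} {d : Fin m → ℕ} {H : Fin m → Type w} [∀ i, TopologicalSpace (H i)]
  (I : ∀ i, ModelWithCorners ℝ (EuclideanSpace ℝ (Fin (d i))) (H i)) {P : Fin m → Type u}
  [∀ i, TopologicalSpace (P i)] [∀ i, ChartedSpace (H i) (P i)]
  (F : (MultiOpen P)ᵒᵖ ⥤ SSet.{u}) (j : Fin m → ℕ)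

theorem isEmpty_ballOpen {k : Fin m → ℤ} {i : Fin m} (hk : k i < 0) (U : MultiOpen P) :
    IsEmpty (BallOpen I k U) :=
  ⟨fun V => by
    obtain ⟨r, hr, -⟩ := V.2.2 i
    omega⟩

/-- A homotopy limit over an empty category is a point. -/
abbrev holimUniqueOfIsEmpty {C : Type w'} [Category.{v} C] [IsEmpty C] (X : C ⥤ SSet.{u})
    (n : SimplexCategoryᵒᵖ) : Unique (HolimSimplex X n) where
  default := ⟨fun c => isEmptyElim c, fun c => isEmptyElim c, fun {c} => isEmptyElim c⟩
  uniq _ := HolimSimplex.ext (funext fun c => isEmptyElim c)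

/-- A zero of `j` on `R` becomes the integer `-1`, and no number of balls is at most `-1`. -/
theorem isEmpty_ballOpen_lower {R : NonemptySubset m} (hR : ¬ ∀ i ∈ R.1, 0 < j i)
    (U : MultiOpen P) : IsEmpty (BallOpen I (lower j R.1) U)ᵒᵖ := by
  push Not at hR
  obtain ⟨i, hi, hji⟩ := hR
  have h : lower j R.1 i < 0 := by
    simp only [lower, hi, if_true]
    omega
  have := isEmpty_ballOpen I h U
  exact ⟨fun V => isEmptyElim V.unop⟩

/-- If `j` is not positive on `R`, then `T_{j_R} F` is a point. -/
abbrev taylorUnique {R : NonemptySubset m} (hR : ¬ ∀ i ∈ R.1, 0 < j i) (U : MultiOpen P)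
    (n : SimplexCategoryᵒᵖ) : Unique ((taylorObj I F (lower j R.1) U).obj n) :=
  haveI := isEmpty_ballOpen_lower I j hR U
  holimUniqueOfIsEmpty _ n

theorem taylorObj_eq {R : NonemptySubset m} (hR : ¬ ∀ i ∈ R.1, 0 < j i) {U : MultiOpen P}
    {n : SimplexCategoryᵒᵖ} (x y : (taylorObj I F (lower j R.1) U).obj n) : x = y :=
  ((taylorUnique I F j hR U n).uniq x).trans ((taylorUnique I F j hR U n).uniq y).symm

/-- The maps underlying the restriction of a simplex of `holim_{k < j} T_k F(U)` along
`R ↦ j_R`. -/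
def toPuncturedApp (U : MultiOpen P) {n : SimplexCategoryᵒᵖ}
    (x : HolimSimplex ((towerBelow I F j).obj (op U)) n) (R : NonemptySubset m)
    (k : SimplexCategoryᵒᵖ) (s : (nerve (Over R)).obj k) (t : k.unop ⟶ n.unop) :
    (taylorObj I F (lower j R.1) U).obj k :=
  if hR : ∀ i ∈ R.1, 0 < j i then
    (taylorMap I F (lower_le_belowOfSubset j R hR) (le_refl U)).app k
      (x.app (belowOfSubset j R hR) k ((nerveMap (overBelow j R hR)).app k s) t)
  -- The target is a point, so this is the only possible value.
  else (taylorUnique I F j hR U k).default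

theorem toPuncturedApp_of_pos {U : MultiOpen P} {n : SimplexCategoryᵒᵖ}
    (x : HolimSimplex ((towerBelow I F j).obj (op U)) n) {R : NonemptySubset m}
    (hR : ∀ i ∈ R.1, 0 < j i) (k : SimplexCategoryᵒᵖ) (s : (nerve (Over R)).obj k)
    (t : k.unop ⟶ n.unop) :
    toPuncturedApp I F j U x R k s t =
      (taylorMap I F (lower_le_belowOfSubset j R hR) (le_refl U)).app k
        (x.app (belowOfSubset j R hR) k ((nerveMap (overBelow j R hR)).app k s) t) :=
  dif_pos hR

/-- The restriction of a simplex of `holim_{k < j} T_k F(U)` along `R ↦ j_R`. -/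
def toPuncturedSimplex (U : MultiOpen P) {n : SimplexCategoryᵒᵖ}
    (x : HolimSimplex ((towerBelow I F j).obj (op U)) n) :
    HolimSimplex (nonemptySubsets (Fin m) ⋙ (taylorCube I F j).obj (op U)) n where
  app R k s t := toPuncturedApp I F j U x R k s t
  map_simplex R k k' g s t := by
    by_cases hR : ∀ i ∈ R.1, 0 < j i
    · have h := x.map_simplex (belowOfSubset j R hR) g ((nerveMap (overBelow j R hR)).app k s) t
      refine (toPuncturedApp_of_pos I F j x hR k' _ _).trans <|
        (congrArg _ h).trans ((NatTrans.naturality_apply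
        (taylorMap I F (lower_le_belowOfSubset j R hR) (le_refl U)) g _).trans ?_)
      exact (congrArg ((taylorObj I F (lower j R.1) U).map g)
        (toPuncturedApp_of_pos I F j x hR k s t)).symm
    · exact taylorObj_eq I F j hR _ _
  map_object {R R'} g k s t := by
    -- The larger set decides: positivity on `R'` passes to `R`, and otherwise the target is a
    -- point.
    by_cases hR' : ∀ i ∈ R'.1, 0 < j i
    · have hR : ∀ i ∈ R.1, 0 < j i := fun i hi => hR' i (g.le hi)
      have h := x.map_object (belowHom j g.le (hR := hR) (hR' := hR')) k
        ((nerveMap (overBelow j R hR)).app k s) t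
      refine (toPuncturedApp_of_pos I F j x hR' k _ _).trans <| (congrArg
        ((taylorMap I F (lower_le_belowOfSubset j R' hR') (le_refl U)).app k) h).trans ?_
      exact (congrArg ((taylorMap I F (lower_anti j g.le) (le_refl U)).app k)
        (toPuncturedApp_of_pos I F j x hR k s t)).symm
    · exact taylorObj_eq I F j hR' _ _

/-- Simplices of `holim_{R ≠ ∅} T_{j_R} F(U)` agree if they agree at the sets `R` on which `j` is
positive. -/
theorem puncturedSimplex_ext {U : MultiOpen P} {n : SimplexCategoryᵒᵖ}
    {x y : HolimSimplex (nonemptySubsets (Fin m) ⋙ (taylorCube I F j).obj (op U)) n}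
    (h : ∀ (R : NonemptySubset m), (∀ i ∈ R.1, 0 < j i) → ∀ k s t,
      x.app R k s t = y.app R k s t) : x = y := by
  refine HolimSimplex.ext (funext fun R => funext fun k => funext fun s => funext fun t => ?_)
  by_cases hR : ∀ i ∈ R.1, 0 < j i
  · exact h R hR k s t
  · exact taylorObj_eq I F j hR _ _

/-- The natural map `holim_{k < j} T_k F ⟶ holim_{R ≠ ∅} T_{j_R} F`. -/
def toPunctured : holimBelow I F j ⟶ puncturedHolim (taylorCube I F j) where
  app U :=
    { app n := TypeCat.ofHom fun x => toPuncturedSimplex I F j U.unop x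
      naturality n n' g := ConcreteCategory.hom_ext _ _ fun x =>
        puncturedSimplex_ext I F j fun R hR k s t =>
          (toPuncturedApp_of_pos I F j _ hR k s t).trans
            (toPuncturedApp_of_pos I F j _ hR k s (t ≫ g.unop)).symm }
  naturality U U' g := by
    refine NatTrans.ext (funext fun n => ConcreteCategory.hom_ext _ _ fun x =>
      puncturedSimplex_ext I F j fun R hR k s t => ?_)
    refine (toPuncturedApp_of_pos I F j _ hR k s t).trans ?_
    exact (congrArg ((taylorMap I F (le_refl (lower j R.1)) g.unop.le).app k)
      (toPuncturedApp_of_pos I F j x hR k s t)).symm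

theorem toHolimBelow_toPunctured :
    toHolimBelow I F j ≫ toPunctured I F j =
      toTaylorCube I F j ≫ cubeMap (taylorCube I F j) :=
  NatTrans.ext (funext fun _ => NatTrans.ext (funext fun _ =>
    ConcreteCategory.hom_ext _ _ fun _ => puncturedSimplex_ext I F j fun _ hR k s t =>
      toPuncturedApp_of_pos I F j _ hR k s t))

/-- The map `holim_{R ≠ ∅} T_{j_R} F(U) ⟶ holim_{k < j} T_k F(U)` induced by `decreased j`. -/
def fromPunctured (U : (MultiOpen P)ᵒᵖ) :
    (puncturedHolim (taylorCube I F j)).obj U ⟶ (holimBelow I F j).obj U :=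
  holimMap (X := nonemptySubsets (Fin m) ⋙ (taylorCube I F j).obj U)
    (Y := (towerBelow I F j).obj U) (decreased j)
    { app k := taylorMap I F (le_lower_decreased j k) (le_refl U.unop)
      naturality _ _ _ := (taylorMap_comp I F _ _ _ _).trans (taylorMap_comp I F _ _ _ _).symm }

theorem fromPunctured_toPunctured (U : (MultiOpen P)ᵒᵖ) :
    fromPunctured I F j U ≫ (toPunctured I F j).app U = 𝟙 _ := by
  refine NatTrans.ext (funext fun n => ConcreteCategory.hom_ext _ _ fun x =>
    puncturedSimplex_ext I F j fun R hR k s t => ?_)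
  refine (toPuncturedApp_of_pos I F j _ hR k s t).trans ?_
  -- The equality `D(j_R) = R` enters as an arrow, so that `map_object` for `x` replaces a transport
  -- between the two components.
  let g : (decreased j).obj (belowOfSubset j R hR) ⟶ R :=
    homOfLE (decreased_belowOfSubset j R hR).le
  let s' := (nerveMap (Over.post (decreased j))).app k ((nerveMap (overBelow j R hR)).app k s)
  have hs : (nerveMap (Over.map g)).app k s' = s :=
    nerve.ext_of_isThin (funext fun i => over_eq_of_left_eq
      (decreased_belowOfSubset j (s.obj i).left fun l hl => hR l ((s.obj i).hom.le hl)))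
  have h := HolimSimplex.map_object x g k s' t
  rw [hs] at h
  exact h.symm

/-- `j` is positive on every `D(k)`, so the default value never occurs, and the successive
restrictions from `j_{D(k)}` to `k` compose to a single one. -/
theorem toPunctured_fromPunctured (U : (MultiOpen P)ᵒᵖ) :
    (toPunctured I F j).app U ≫ fromPunctured I F j U =
      holimDeflation (belowDeflationCounit j) ((towerBelow I F j).obj U) := by
  refine NatTrans.ext (funext fun n => ConcreteCategory.hom_ext _ _ fun x => HolimSimplex.ext
    (funext fun k => funext fun l => funext fun s => funext fun t => ?_))
  exact congrArg ((taylorMap I F (le_lower_decreased j k) (le_refl U.unop)).app l)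
    (toPuncturedApp_of_pos I F j x (pos_of_mem_decreased j k) l
      ((nerveMap (Over.post (decreased j))).app l s) t)

/-- The composite of `toPunctured` and `fromPunctured` is homotopic to the identity. -/
noncomputable def puncturedHomotopy (U : (MultiOpen P)ᵒᵖ) :
    SSet.Homotopy ((toPunctured I F j).app U ≫ fromPunctured I F j U)
      (𝟙 ((holimBelow I F j).obj U)) where
  -- Only the endpoint equation is rewritten; keeping the homotopy itself untouched lets its
  -- stationarity hold by `rfl`.
  h := holimDeflationMap (belowDeflationCounit j) ((towerBelow I F j).obj U)
  h₀ := (holimDeflationHomotopy (belowDeflationCounit j) ((towerBelow I F j).obj U)).h₀.trans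
    (toPunctured_fromPunctured I F j U).symm
  h₁ := (holimDeflationHomotopy (belowDeflationCounit j) ((towerBelow I F j).obj U)).h₁
  rel := (holimDeflationHomotopy (belowDeflationCounit j) ((towerBelow I F j).obj U)).rel

/-- A simplex built from a cone ignores the chain in the slice, which is all that the homotopy
deforms. -/
theorem toHolimBelow_puncturedHomotopy (U : (MultiOpen P)ᵒᵖ) :
    (toHolimBelow I F j).app U ▷ Δ[1] ≫ (puncturedHomotopy I F j U).h =
      CartesianMonoidalCategory.fst _ _ ≫ (toHolimBelow I F j).app U :=
  rfl

theorem isFunctorEquivalence_toPunctured : IsFunctorEquivalence (toPunctured I F j) := fun U =>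
  ⟨fromPunctured I F j U, .of_homotopy (puncturedHomotopy I F j U), by
    rw [fromPunctured_toPunctured]
    exact .refl _⟩

theorem le_lower_empty : (fun i => (j i : ℤ)) ≤ lower j ∅ := by
  intro i
  simp [lower]

/-- The isomorphism from `T_j F` to the initial vertex of the cube. -/
def taylorCubeIso (U : (MultiOpen P)ᵒᵖ) :
    (taylor I F fun i => (j i : ℤ)).obj U ≅
      (taylorCube I F j ⋙ (evaluation (Finset (Fin m)) SSet.{u}).obj ∅).obj U where
  hom := (toTaylorCube I F j).app U
  inv := taylorMap I F (le_lower_empty j) (le_refl U.unop)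
  hom_inv_id := rfl
  inv_hom_id := rfl

theorem taylorCubeIso_inv_toHolimBelow (U : (MultiOpen P)ᵒᵖ) :
    (taylorCubeIso I F j U).inv ≫ (toHolimBelow I F j).app U =
      (cubeMap (taylorCube I F j)).app U ≫ fromPunctured I F j U :=
  rfl

theorem toPunctured_basepoint (x₀ : (F.obj (op ⊤)) _⦋0⦌) (U : (MultiOpen P)ᵒᵖ) :
    ((toPunctured I F j).app U).app _
        ((((basepointOfTop x₀).map (toTaylor I F _)).map (toHolimBelow I F j)).pt U) =
      ((taylorCubeBasepoint I F j x₀).map (cubeMap (taylorCube I F j))).pt U :=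
  ConcreteCategory.congr_hom
    (NatTrans.congr_app (NatTrans.congr_app (toHolimBelow_toPunctured I F j) U) (op ⦋0⦌))
    (((basepointOfTop x₀).map (toTaylor I F _)).pt U)

/-! ### The layer and the total homotopy fiber -/

/-- The natural map from the layer to the total homotopy fiber of the cube. -/
def layerToTfiber (x₀ : (F.obj (op ⊤)) _⦋0⦌) :
    layer I F j x₀ ⟶ tfiber (taylorCube I F j) (taylorCubeBasepoint I F j x₀) :=
  hofiberFunctorMap (toTaylorCube I F j) (toPunctured I F j)
    (toHolimBelow_toPunctured I F j).symm (toPunctured_basepoint I F j x₀)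

theorem isFunctorEquivalence_layerToTfiber (x₀ : (F.obj (op ⊤)) _⦋0⦌) :
    IsFunctorEquivalence (layerToTfiber I F j x₀) := fun U =>
  isEquivalence_hofiberMap (taylorCubeIso I F j U) ((toPunctured I F j).app U)
    (fromPunctured I F j U) (NatTrans.congr_app (toHolimBelow_toPunctured I F j).symm U)
    (taylorCubeIso_inv_toHolimBelow I F j U) (fromPunctured_toPunctured I F j U)
    (puncturedHomotopy I F j U) (toHolimBelow_puncturedHomotopy I F j U)
    (((basepointOfTop x₀).map (toTaylor I F _)).pt U) (toPunctured_basepoint I F j x₀ U)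

end Comparison

end ManifoldCalculus

theorem mainTheorem9 {m : ℕ} {d : Fin m → ℕ} {H : Fin m → Type w} [∀ i, TopologicalSpace (H i)]
    (I : ∀ i, ModelWithCorners ℝ (EuclideanSpace ℝ (Fin (d i))) (H i)) {P : Fin m → Type u}
    [∀ i, TopologicalSpace (P i)] [∀ i, ChartedSpace (H i) (P i)]
    [∀ i, IsManifold (I i) ∞ (P i)] [∀ i, CompactSpace (P i)] [∀ i, T2Space (P i)]
    (F : (MultiOpen P)ᵒᵖ ⥤ SSet.{u}) (hF : ∀ U, SSet.KanComplex (F.obj U))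
    (j : Fin m → ℕ) :
    ∃ φ : holimBelow I F j ⟶
        puncturedHolim (taylorCube I F j),
      IsFunctorEquivalence φ ∧
      toHolimBelow I F j ≫ φ =
        toTaylorCube I F j ≫
          cubeMap (taylorCube I F j) ∧
      ∀ x₀ : (F.obj (op ⊤)) _⦋0⦌,
        ∃ θ : layer I F j x₀ ⟶
            tfiber (taylorCube I F j)
              (taylorCubeBasepoint I F j x₀),
          IsFunctorEquivalence θ ∧
          θ ≫ hofiberProj _ _ =
            hofiberProj _ _ ≫ toTaylorCube I F j :=
  ⟨toPunctured I F j, isFunctorEquivalence_toPunctured I F j, toHolimBelow_toPunctured I F j,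
    fun x₀ => ⟨layerToTfiber I F j x₀, isFunctorEquivalence_layerToTfiber I F j x₀, rfl⟩⟩
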